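/- Let $N$ be a smooth (Hausdorff, second countable) manifold with or without boundary, and let $\Theta:\mathbb{R}\times N\to N$ be a smooth $\mathbb{R}$-action that is proper, i.e. the shear map $\mathbb{R}\times N\to N\times N$, $(s,p)\mapsto (p,\Theta(s,p))$, is a proper map. Let $\pi:N\to N/\mathbb{R}$ be the quotient map onto the orbit space, where $N/\mathbb{R}$ carries its quotient smooth structure (the unique one for which $\pi$ is smooth and has smooth local sections, so that $\pi$ is a smooth principal $\mathbb{R}$-bundle). Let $X_p=\frac{\mathrm{d}}{\mathrm{d}s}\big|_{s=0}\Theta(s,p)$ be the fundamental vector field. For a compactly supported smooth form $\alpha\in\Omega^{k+1}_{\mathrm c}(N)$, $k\ge 0$, define $$G^\uparrow_\Theta\alpha:=\int_{\mathbb{R}^{\le 0}}\Theta^*\alpha,\qquad G^\downarrow_\Theta\alpha:=-\int_{\mathbb{R}^{\ge 0}}\Theta^*\alpha,$$ where, for a $(k+1)$-form $\beta$ on $\mathbb{R}\times N$ and $A\subseteq\mathbb{R}$, the fiber integral over $A\times N\to N$ is $$\Big(\int_A\beta\Big)_p(v_1,\dots,v_k)=\int_A\beta_{(s,p)}(\partial_s,v_1,\dots,v_k)\,\mathrm{d}s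 .$$ Let $\pi_*\alpha$ be the fiber integral of $\alpha$ along $\pi$, $$(\pi_*\alpha)_b(v_1,\dots,v_k)=\int_{\mathbb{R}}\alpha_{\Theta(s,p)}\big(X,\tilde v_1(s),\dots,\tilde v_k(s)\big)\,\mathrm{d}s,$$ where $p$ is any point of the orbit $\pi^{-1}(b)$ and $\tilde v_i(s)\in T_{\Theta(s,p)}N$ is any lift of $v_i\in T_b(N/\mathbb{R})$ along $\mathrm{d}\pi$. Then all these integrals converge, they define linear maps $$G^\uparrow_\Theta,\ G^\downarrow_\Theta:\Omega^{k+1}_{\mathrm c}(N)\to\Omega^{k}(N),\qquad \pi_*:\Omega^{k+1}_{\mathrm c}(N)\to\Omega^{k}(N/\mathbb{R})$$ into smooth forms for every $k\ge 0$, the pullback $\pi^*$ is a linear map $\Omega^k(N/\mathbb{R})\to\Omega^k(N)$, and $$G^\uparrow_\Theta-G^\downarrow_\Theta=\pi^*\,\pi_*:\Omega^{k+1}_{\mathrm c}(N)\longrightarrow\Omega^{k}(N).$$ -/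

import Mathlib

open Set MeasureTheory Topology
open scoped Manifold ContDiff

noncomputable section

section Forms

variable {E H M : Type*} [NormedAddCommGroup E] [NormedSpace ℝ E] [TopologicalSpace H]
  (I : ModelWithCorners ℝ E H) [TopologicalSpace M] [ChartedSpace H M]

/-- The differential at `y` of the inverse of the preferred chart of the manifold `M` at `x₀`, from
`E` to the tangent space of `M` (which Mathlib defines to be the model vector space `E`). -/
def chartInvDeriv (x₀ : M) (y : E) : E →L[ℝ] E :=
  mfderiv[range I] (extChartAt I x₀).symm y

/-- The representation of a `k`-form `η` on `M` in the preferred chart at `x₀`: the pullback of `η`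
along the inverse of that chart. A `k`-form is a function `η : M → E [⋀^Fin k]→L[ℝ] ℝ`, where `η p`
is an alternating form on `TangentSpace I p = E`. -/
def formInChart {k : ℕ} (η : M → E [⋀^Fin k]→L[ℝ] ℝ) (x₀ : M) : E → E [⋀^Fin k]→L[ℝ] ℝ :=
  fun y => (η ((extChartAt I x₀).symm y)).compContinuousLinearMap (chartInvDeriv I x₀ y)

/-- The space `Ω^k(M)` of smooth `k`-forms: the pullback along the inverse of every chart is
smooth. -/
def smoothForms (M : Type*) [TopologicalSpace M] [ChartedSpace H M] (k : ℕ) :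
    Submodule ℝ (M → E [⋀^Fin k]→L[ℝ] ℝ) where
  carrier := {η | ∀ x₀ : M, ContDiffOn ℝ ∞ (formInChart I η x₀) (extChartAt I x₀).target}
  zero_mem' := fun x₀ => by
    have h : formInChart I (0 : M → E [⋀^Fin k]→L[ℝ] ℝ) x₀ = fun _ => 0 := by
      funext y; ext v; simp [formInChart]
    rw [h]; exact contDiffOn_const
  add_mem' := fun {a b} ha hb x₀ => by
    have h : formInChart I (a + b) x₀ = fun y => formInChart I a x₀ y + formInChart I b x₀ y := by
      funext y; ext v; simp [formInChart]
    rw [h]; exact (ha x₀).add (hb x₀)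
  smul_mem' := fun c a ha x₀ => by
    have h : formInChart I (c • a) x₀ = fun y => c • formInChart I a x₀ y := by
      funext y; ext v; simp [formInChart]
    rw [h]; exact (ha x₀).const_smul c

/-- The space `Ω_c^k(M)` of compactly supported smooth `k`-forms. -/
def compactForms (M : Type*) [TopologicalSpace M] [ChartedSpace H M] (k : ℕ) :
    Submodule ℝ (M → E [⋀^Fin k]→L[ℝ] ℝ) where
  carrier := {η | η ∈ smoothForms I M k ∧ HasCompactSupport η}
  zero_mem' := ⟨(smoothForms I M k).zero_mem, HasCompactSupport.zero⟩
  add_mem' := fun ha hb => ⟨(smoothForms I M k).add_mem ha.1 hb.1, ha.2.add hb.2⟩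
  smul_mem' := fun c a ha => ⟨(smoothForms I M k).smul_mem c ha.1,
    ha.2.mono' (fun x hx => subset_tsupport a (fun h0 => hx (by simp [h0])))⟩

variable {E' H' M' : Type*} [NormedAddCommGroup E'] [NormedSpace ℝ E'] [TopologicalSpace H']
  (I' : ModelWithCorners ℝ E' H') [TopologicalSpace M'] [ChartedSpace H' M']

/-- The differential of a map of manifolds at `p`, as a map of the model vector spaces. -/
def modelDeriv (f : M → M') (p : M) : E →L[ℝ] E' := mfderiv I I' f p

/-- Pullback `f^* η` of a form along a map of manifolds. -/
def formPullback {k : ℕ} (f : M → M') (η : M' → E' [⋀^Fin k]→L[ℝ] ℝ) :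
    M → E [⋀^Fin k]→L[ℝ] ℝ :=
  fun p => (η (f p)).compContinuousLinearMap (modelDeriv I I' f p)

end Forms

section Projection

variable {E M : Type*} [NormedAddCommGroup E] [NormedSpace ℝ E]

/-- For a `(k+1)`-form `β` on `ℝ × M`, the form `v ↦ β_(s,p)(∂_s, v₁, …, v_k)` on the tangent
space of `M` at `p`. -/
def prIntegrand {k : ℕ} (β : ℝ × M → (ℝ × E) [⋀^Fin (k + 1)]→L[ℝ] ℝ) (p : M) (s : ℝ) :
    E [⋀^Fin k]→L[ℝ] ℝ :=
  ((β (s, p)).curryLeft (1, 0)).compContinuousLinearMap (ContinuousLinearMap.inr ℝ ℝ E)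

/-- Integration of a `(k+1)`-form on `ℝ × M` over the fibers of `pr : A × M → M`, for `A ⊆ ℝ` with
its standard orientation, in the fiber-first convention
(`f ds ∧ φ ↦ (∫_A f ds) φ` for `φ` without `ds`-leg). -/
def prIntegral {k : ℕ} (A : Set ℝ) (β : ℝ × M → (ℝ × E) [⋀^Fin (k + 1)]→L[ℝ] ℝ) :
    M → E [⋀^Fin k]→L[ℝ] ℝ :=
  fun p => ∫ s in A, prIntegrand β p s

end Projection

section Action

variable {E H N : Type*} [NormedAddCommGroup E] [NormedSpace ℝ E] [TopologicalSpace H]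
  (I : ModelWithCorners ℝ E H) [TopologicalSpace N] [ChartedSpace H N] [AddAction ℝ N]

/-- The action map `Θ : ℝ × N → N`. -/
def flowMap (N : Type*) [AddAction ℝ N] : ℝ × N → N := fun x => x.1 +ᵥ x.2

/-- `Θ^* α` for a form `α` on `N`. -/
def flowPullback {k : ℕ} (α : N → E [⋀^Fin k]→L[ℝ] ℝ) : ℝ × N → (ℝ × E) [⋀^Fin k]→L[ℝ] ℝ :=
  formPullback (𝓘(ℝ, ℝ).prod I) I (flowMap N) α

/-- `G^↑_Θ α = ∫_{ℝ^{≤ 0}} Θ^* α`. -/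
def greenForward {k : ℕ} (α : N → E [⋀^Fin (k + 1)]→L[ℝ] ℝ) : N → E [⋀^Fin k]→L[ℝ] ℝ :=
  prIntegral (Iic 0) (flowPullback I α)

/-- `G^↓_Θ α = - ∫_{ℝ^{≥ 0}} Θ^* α`. -/
def greenBackward {k : ℕ} (α : N → E [⋀^Fin (k + 1)]→L[ℝ] ℝ) : N → E [⋀^Fin k]→L[ℝ] ℝ :=
  -prIntegral (Ici 0) (flowPullback I α)

/-- The fundamental vector field `X_p = d/ds|_{s = 0} Θ(s, p)` of the action. -/
def flowField (p : N) : E := modelDeriv 𝓘(ℝ, ℝ) I (fun s : ℝ => s +ᵥ p) 0 1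

/-- The quotient map `π : N → N/ℝ` to the orbit space (with the quotient topology). -/
def orbitMap (N : Type*) [AddAction ℝ N] : N → AddAction.orbitRel.Quotient ℝ N :=
  Quotient.mk _

variable {E' H' : Type*} [NormedAddCommGroup E'] [NormedSpace ℝ E'] [TopologicalSpace H']
  (I' : ModelWithCorners ℝ E' H') [ChartedSpace H' (AddAction.orbitRel.Quotient ℝ N)]

/-- The given smooth structure on the orbit space `N/ℝ` is the quotient smooth structure:
the quotient map `π : N → N/ℝ` is smooth and has smooth local sections. There is at most one such
structure, since a function on `N/ℝ` is then smooth if and only if its composition with `π` is. -/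
structure IsQuotientManifold : Prop where
  contMDiff_orbitMap : ContMDiff I I' ∞ (orbitMap N)
  exists_local_section : ∀ b : AddAction.orbitRel.Quotient ℝ N, ∃ U ∈ 𝓝 b,
    ∃ σ : AddAction.orbitRel.Quotient ℝ N → N,
      ContMDiffOn I' I ∞ σ U ∧ ∀ c ∈ U, orbitMap N (σ c) = c

/-- A linear choice `T_{π(q)}(N/ℝ) → T_q N` of lifts of tangent vectors along `dπ_q`. -/
def tangentLift (q : N) : E' →L[ℝ] E :=
  Classical.epsilon fun R : E' →L[ℝ] E => ∀ v : E', modelDeriv I I' (orbitMap N) q (R v) = v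

/-- For a `(k+1)`-form `α` on `N` and `q` in the fiber over `b = π(q)`, the form
`(v₁, …, v_k) ↦ α_q(X_q, ṽ₁, …, ṽ_k)` on `T_b(N/ℝ)`, where `ṽᵢ ∈ T_q N` lifts `vᵢ`. As `X_q` spans
the kernel of `dπ_q`, it does not depend on the lifts. -/
def orbitIntegrand {k : ℕ} (α : N → E [⋀^Fin (k + 1)]→L[ℝ] ℝ) (q : N) :
    E' [⋀^Fin k]→L[ℝ] ℝ :=
  ((α q).curryLeft (flowField I q)).compContinuousLinearMap (tangentLift I I' q)

/-- Fiber integration `π_*` along the quotient map, in the fiber-first convention. The fiber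
over `b` is the orbit of any point `p` over `b`. It is parametrized by `s ↦ Θ(s, p)`, with velocity
`X`, and oriented by `X`. -/
def fiberIntegral {k : ℕ} (α : N → E [⋀^Fin (k + 1)]→L[ℝ] ℝ) :
    AddAction.orbitRel.Quotient ℝ N → E' [⋀^Fin k]→L[ℝ] ℝ :=
  fun b => ∫ s : ℝ, orbitIntegrand I I' α (s +ᵥ b.out)

end Action

end

/-! Both sides equal the integral of `Θ^*α` over all of `ℝ`. For `G^↑ - G^↓` this holds because the
sign in `G^↓` turns the difference into the sum of two half-line integrals.

For `π^*π_*α`, compare integrands at time `s`. One is `α(X, dΘ_s v₁, …, dΘ_s v_k)`; the other is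
`α(X, ṽ₁, …, ṽ_k)` with `ṽᵢ` a lift of `dπ vᵢ`. Since `π ∘ Θ_s = π`, the vector `dΘ_s vᵢ` is also
such a lift, so the two differ by an element of `ker dπ = ℝX`, which contraction with `X` kills
(`orbitIntegrand_comp_modelDeriv`).

That `ker dπ = ℝX` (`exists_eq_smul_flowField`) is a dimension count. The field `X` lies in the
kernel, and it vanishes nowhere because a proper action of `ℝ` has no fixed points. The kernel is at
most a line: for a local section `σ`, the smooth map `(s, c) ↦ Θ(s, σ(c))` covers an open set of
`N`, and a `C^1` map cannot raise Hausdorff dimension, so `dim N ≤ dim(N/ℝ) + 1`.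

Convergence and smoothness rest on properness: for `q` near a given point, the times at which `Θ(s,
q)` meets the support of `α` lie in one compact interval. In a chart one then differentiates under
the integral (`prIntegral_mem_smoothForms`). Smoothness of `π_*α` follows since locally it is the
pullback along `σ` of the integral of `Θ^*α` over `ℝ`. -/

noncomputable section

/-! ### Smooth dependence of the pullback of alternating maps -/

section AlternatingPullback

lemma ContinuousMultilinearMap.contDiff_compContinuousLinearMapContinuousMultilinear
    {𝕜 ι E E' G : Type*} [NontriviallyNormedField 𝕜] [Fintype ι] [NormedAddCommGroup E]
    [NormedSpace 𝕜 E] [NormedAddCommGroup E'] [NormedSpace 𝕜 E'] [NormedAddCommGroup G]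
    [NormedSpace 𝕜 G] {n : ℕ∞ω} :
    ContDiff 𝕜 n (ContinuousMultilinearMap.compContinuousLinearMapContinuousMultilinear 𝕜
      (fun _ : ι => E) (fun _ : ι => E') G) :=
  ContinuousMultilinearMap.contDiff _

variable {E E' G : Type*} [NormedAddCommGroup E] [NormedSpace ℝ E] [NormedAddCommGroup E']
  [NormedSpace ℝ E'] [NormedAddCommGroup G] [NormedSpace ℝ G]

/-- The projection of continuous multilinear maps onto continuous alternating maps. -/
def alternatingProjection (k : ℕ) :
    ContinuousMultilinearMap ℝ (fun _ : Fin k => E) ℝ →L[ℝ] E [⋀^Fin k]→L[ℝ] ℝ :=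
  LinearMap.mkContinuous
    { toFun := fun f => ((k.factorial : ℝ)⁻¹) • ContinuousMultilinearMap.alternatization f
      map_add' := fun f g => by simp
      map_smul' := fun c f => by
        ext v
        simp only [ContinuousAlternatingMap.smul_apply, RingHom.id_apply, smul_eq_mul,
          ContinuousMultilinearMap.alternatization_apply_apply, Finset.mul_sum,
          _root_.smul_apply]
        refine Finset.sum_congr rfl fun σ _ => ?_
        rw [← smul_eq_mul c (f _), smul_comm _ c, smul_eq_mul, mul_left_comm] }
    1 fun f => by
      refine ContinuousAlternatingMap.opNorm_le_bound _ (by positivity) fun v => ?_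
      simp only [LinearMap.coe_mk, AddHom.coe_mk, ContinuousAlternatingMap.smul_apply,
        ContinuousMultilinearMap.alternatization_apply_apply, norm_smul, one_mul]
      -- The sum has `k!` terms, each bounded by `‖f‖ ∏ ‖v i‖`, so the normalised average has norm
      -- at most that of `f`.
      have h : ‖∑ σ : Equiv.Perm (Fin k), Equiv.Perm.sign σ • f (v ∘ σ)‖ ≤
          ∑ _σ : Equiv.Perm (Fin k), ‖f‖ * ∏ i, ‖v i‖ := by
        refine norm_sum_le_of_le _ fun σ _ => ?_
        have h1 : ‖Equiv.Perm.sign σ • f (v ∘ σ)‖ = ‖f (v ∘ σ)‖ := by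
          rcases Int.units_eq_one_or (Equiv.Perm.sign σ) with h | h <;> simp [h]
        rw [h1, ← Equiv.prod_comp σ fun i => ‖v i‖]
        exact f.le_opNorm _
      rw [Finset.sum_const, Finset.card_univ, Fintype.card_perm, Fintype.card_fin,
        nsmul_eq_mul] at h
      have hk : (0 : ℝ) < k.factorial := by positivity
      rw [norm_inv, Real.norm_natCast, inv_mul_le_iff₀ hk]
      exact h

lemma alternatingProjection_coe {k : ℕ} (f : E [⋀^Fin k]→L[ℝ] ℝ) :
    alternatingProjection k f.toContinuousMultilinearMap = f := by
  ext v
  have h (σ : Equiv.Perm (Fin k)) : Equiv.Perm.sign σ • f (v ∘ σ) = f v := by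
    have := f.toAlternatingMap.map_perm v σ
    simp only [ContinuousAlternatingMap.coe_toAlternatingMap] at this
    rw [this, smul_smul, Int.units_mul_self, one_smul]
  have hk : (k.factorial : ℝ) ≠ 0 := by positivity
  simp only [alternatingProjection, LinearMap.mkContinuous_apply, LinearMap.coe_mk, AddHom.coe_mk,
    ContinuousAlternatingMap.smul_apply, ContinuousMultilinearMap.alternatization_apply_apply,
    ContinuousAlternatingMap.coe_toContinuousMultilinearMap, h]
  rw [Finset.sum_const, Finset.card_univ, Fintype.card_perm, Fintype.card_fin, nsmul_eq_mul,
    smul_eq_mul, inv_mul_cancel_left₀ hk]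

/-- Pulling back alternating maps is smooth jointly in the alternating map and the linear map. -/
lemma ContDiffWithinAt.compContinuousLinearMap_alternating {k : ℕ} {n : ℕ∞ω} {s : Set G} {x : G}
    {f : G → E' [⋀^Fin k]→L[ℝ] ℝ} {L : G → E →L[ℝ] E'} (hf : ContDiffWithinAt ℝ n f s x)
    (hL : ContDiffWithinAt ℝ n L s x) :
    ContDiffWithinAt ℝ n (fun y => (f y).compContinuousLinearMap (L y)) s x := by
  -- For multilinear maps the pullback is itself multilinear in the family of linear maps, hence
  -- smooth. Embed into multilinear maps, pull back there, and project back.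
  let Φ := ContinuousMultilinearMap.compContinuousLinearMapContinuousMultilinear ℝ
    (fun _ : Fin k => E) (fun _ : Fin k => E') ℝ
  have h1 : ContDiffWithinAt ℝ n (fun y => Φ fun _ => L y) s x :=
    ContinuousMultilinearMap.contDiff_compContinuousLinearMapContinuousMultilinear.contDiffAt
      |>.comp_contDiffWithinAt (f := fun y (_ : Fin k) => L y) x
      (contDiffWithinAt_pi.2 fun _ => hL)
  have h2 : ContDiffWithinAt ℝ n (fun y => (f y).toContinuousMultilinearMap) s x :=
    (ContinuousAlternatingMap.toContinuousMultilinearMapCLM ℝ :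
      (E' [⋀^Fin k]→L[ℝ] ℝ) →L[ℝ] _).contDiff.contDiffAt.comp_contDiffWithinAt x hf
  have h3 := (alternatingProjection (E := E) k).contDiff.contDiffAt.comp_contDiffWithinAt x
    (h1.clm_apply h2)
  refine h3.congr_of_eventuallyEq (Filter.Eventually.of_forall fun y => ?_) ?_
  · exact (alternatingProjection_coe _).symm
  · exact (alternatingProjection_coe _).symm

end AlternatingPullback

/-! ### Differentiation under the integral sign -/

section ParametricIntegral

universe u

variable {E : Type u} [NormedAddCommGroup E]

/-- Compactness of `K` makes continuity in `y` uniform in the time `s`. -/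
lemma exists_mem_nhdsWithin_norm_sub_lt {F : Type*} [NormedAddCommGroup F] {g : ℝ × E → F}
    {C : Set E} {K : Set ℝ} (hK : IsCompact K) (hg : ContinuousOn g (univ ×ˢ C)) {y₀ : E}
    (hy₀ : y₀ ∈ C) {ε : ℝ} (hε : 0 < ε) :
    ∃ v ∈ 𝓝[C] y₀, ∀ y ∈ v, ∀ s ∈ K, ‖g (s, y) - g (s, y₀)‖ < ε := by
  have h : ContinuousOn (Function.uncurry fun (y : E) (s : ℝ) => g (s, y)) (C ×ˢ K) :=
    hg.comp continuous_swap.continuousOn fun z hz => ⟨mem_univ _, hz.1⟩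
  obtain ⟨v, hv, hv'⟩ := hK.mem_uniformity_of_prod h hy₀ (Metric.dist_mem_uniformity hε)
  refine ⟨v, hv, fun y hy s hs => ?_⟩
  simpa [dist_eq_norm] using hv' y hy s hs

lemma integrableOn_slice {F : Type*} [NormedAddCommGroup F] {g : ℝ × E → F} {C : Set E}
    {A K : Set ℝ} (hK : IsCompact K) (hAK : A ⊆ K) (hg : ContinuousOn g (univ ×ˢ C)) {y : E}
    (hy : y ∈ C) : IntegrableOn (fun s => g (s, y)) A :=
  ((hg.comp (f := fun s : ℝ => (s, y)) (by fun_prop) fun _ _ => ⟨mem_univ _, hy⟩ :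
    ContinuousOn (fun s => g (s, y)) K).integrableOn_compact hK).mono_set hAK

lemma continuousOn_setIntegral {F : Type*} [NormedAddCommGroup F] [NormedSpace ℝ F]
    {g : ℝ × E → F} {C : Set E} {A K : Set ℝ} (hK : IsCompact K)
    (hAK : A ⊆ K) (hg : ContinuousOn g (univ ×ˢ C)) :
    ContinuousOn (fun y => ∫ s in A, g (s, y)) C := by
  intro y₀ hy₀
  have hAfin : volume A < ⊤ := (measure_mono hAK).trans_lt hK.measure_lt_top
  rw [ContinuousWithinAt, Metric.tendsto_nhds]
  intro ε hε
  -- The `+ 1` keeps the denominator positive when `A` is a null set.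
  obtain ⟨v, hv, hv'⟩ := exists_mem_nhdsWithin_norm_sub_lt hK hg hy₀
    (ε := ε / (volume.real A + 1)) (by positivity)
  filter_upwards [hv, self_mem_nhdsWithin] with y hy hyC
  rw [dist_eq_norm, ← integral_sub (integrableOn_slice hK hAK hg hyC)
    (integrableOn_slice hK hAK hg hy₀)]
  refine (norm_setIntegral_le_of_norm_le_const hAfin
    fun s hs => (hv' y hy s (hAK hs)).le).trans_lt ?_
  rw [div_mul_eq_mul_div, div_lt_iff₀ (by positivity)]
  nlinarith [measureReal_nonneg (μ := (volume : Measure ℝ)) (s := A)]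

variable [NormedSpace ℝ E]

/-- The mean value inequality on the convex set `C ∩ ball y₀ δ` bounds the first-order remainder of
each slice, uniformly in `s`, by the oscillation of `g'`. -/
lemma hasFDerivWithinAt_setIntegral {F : Type*} [NormedAddCommGroup F] [NormedSpace ℝ F]
    [CompleteSpace F]
    {g : ℝ × E → F} {g' : ℝ × E → E →L[ℝ] F} {C : Set E} {A K : Set ℝ} (hC : Convex ℝ C)
    (hK : IsCompact K) (hAK : A ⊆ K) (hg : ContinuousOn g (univ ×ˢ C))
    (hg' : ContinuousOn g' (univ ×ˢ C))
    (hd : ∀ s, ∀ y ∈ C, HasFDerivWithinAt (fun z => g (s, z)) (g' (s, y)) C y) {y₀ : E}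
    (hy₀ : y₀ ∈ C) :
    HasFDerivWithinAt (fun y => ∫ s in A, g (s, y)) (∫ s in A, g' (s, y₀)) C y₀ := by
  have hAfin : volume A < ⊤ := (measure_mono hAK).trans_lt hK.measure_lt_top
  rw [hasFDerivWithinAt_iff_isLittleO, Asymptotics.isLittleO_iff]
  intro ε hε
  obtain ⟨v, hv, hv'⟩ := exists_mem_nhdsWithin_norm_sub_lt hK hg' hy₀
    (ε := ε / (volume.real A + 1)) (by positivity)
  obtain ⟨δ, hδ, hδv⟩ := Metric.mem_nhdsWithin_iff.1 hv
  filter_upwards [inter_mem_nhdsWithin C (Metric.ball_mem_nhds y₀ hδ)] with y hy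
  have hi := integrableOn_slice hK hAK hg' hy₀
  rw [ContinuousLinearMap.integral_apply hi, ← integral_sub (integrableOn_slice hK hAK hg hy.1)
    (integrableOn_slice hK hAK hg hy₀), ← integral_sub]
  rotate_left
  · exact (integrableOn_slice hK hAK hg hy.1).sub (integrableOn_slice hK hAK hg hy₀)
  · exact hi.apply_continuousLinearMap _
  refine (norm_setIntegral_le_of_norm_le_const (C := ε / (volume.real A + 1) * ‖y - y₀‖) hAfin
    fun s hs => ?_).trans ?_
  · have hconv : Convex ℝ (C ∩ Metric.ball y₀ δ) := hC.inter (convex_ball _ _)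
    exact hconv.norm_image_sub_le_of_norm_hasFDerivWithin_le'
      (fun z hz => (hd s z hz.1).mono inter_subset_left)
      (fun z hz => (hv' z (hδv ⟨hz.2, hz.1⟩) s (hAK hs)).le) ⟨hy₀, Metric.mem_ball_self hδ⟩ hy
  · rw [mul_right_comm]
    refine mul_le_mul_of_nonneg_right ?_ (norm_nonneg _)
    rw [div_mul_eq_mul_div, div_le_iff₀ (by positivity)]
    nlinarith [measureReal_nonneg (μ := (volume : Measure ℝ)) (s := A)]

/-- The derivative is again such an integral, now with values in `E →L[ℝ] F`. The induction
therefore quantifies over `F`, in the universe of `E` so that the new target stays in it. -/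
lemma contDiffOn_setIntegral_nat {C : Set E} {A K : Set ℝ} (hC : Convex ℝ C)
    (hCu : UniqueDiffOn ℝ C) (hK : IsCompact K) (hAK : A ⊆ K) (n : ℕ) :
    ∀ {F : Type u} [NormedAddCommGroup F] [NormedSpace ℝ F] [CompleteSpace F] {g : ℝ × E → F},
      ContDiffOn ℝ n g (univ ×ˢ C) → ContDiffOn ℝ n (fun y => ∫ s in A, g (s, y)) C := by
  induction n with
  | zero =>
    intro F _ _ _ g hg
    simp only [Nat.cast_zero, contDiffOn_zero] at hg ⊢
    exact continuousOn_setIntegral hK hAK hg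
  | succ n ih =>
    intro F _ _ _ g hg
    have hu : UniqueDiffOn ℝ ((univ : Set ℝ) ×ˢ C) := uniqueDiffOn_univ.prod hCu
    have hg' : ContDiffOn ℝ n (fun z => (fderivWithin ℝ g (univ ×ˢ C) z).comp
        (ContinuousLinearMap.inr ℝ ℝ E)) (univ ×ˢ C) :=
      (hg.fderivWithin hu (by norm_cast)).clm_comp contDiffOn_const
    push_cast
    rw [contDiffOn_succ_iff_hasFDerivWithinAt_of_uniqueDiffOn hCu]
    refine ⟨by simp, _, ih hg', fun y₀ hy₀ => ?_⟩
    refine hasFDerivWithinAt_setIntegral hC hK hAK hg.continuousOn hg'.continuousOn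
      (fun s y hy => ?_) hy₀
    have h1 : HasFDerivWithinAt g (fderivWithin ℝ g (univ ×ˢ C) (s, y)) (univ ×ˢ C) (s, y) :=
      (hg.differentiableOn (by simp) (s, y) ⟨mem_univ _, hy⟩).hasFDerivWithinAt
    exact h1.comp y (hasFDerivAt_prodMk_right s y).hasFDerivWithinAt
      fun z hz => ⟨mem_univ _, hz⟩

/-- The integral over a bounded set of a smooth family of functions on a convex set with unique
differentials is smooth. -/
lemma contDiffOn_setIntegral {F : Type u} [NormedAddCommGroup F] [NormedSpace ℝ F]
    [CompleteSpace F] {C : Set E} {A K : Set ℝ} (hC : Convex ℝ C) (hCu : UniqueDiffOn ℝ C)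
    (hK : IsCompact K) (hAK : A ⊆ K) {g : ℝ × E → F}
    (hg : ContDiffOn ℝ ∞ g (univ ×ˢ C)) : ContDiffOn ℝ ∞ (fun y => ∫ s in A, g (s, y)) C :=
  contDiffOn_infty.2 fun n =>
    contDiffOn_setIntegral_nat hC hCu hK hAK n (contDiffOn_infty.1 hg n)

end ParametricIntegral

/-! ### Pullback of forms in charts -/

section Pullback

variable {E H M : Type*} [NormedAddCommGroup E] [NormedSpace ℝ E] [TopologicalSpace H]
  {I : ModelWithCorners ℝ E H} [TopologicalSpace M] [ChartedSpace H M]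
  {E' H' M' : Type*} [NormedAddCommGroup E'] [NormedSpace ℝ E'] [TopologicalSpace H']
  {I' : ModelWithCorners ℝ E' H'} [TopologicalSpace M'] [ChartedSpace H' M']

lemma extChartAt_mem_range (x₀ q : M) : extChartAt I x₀ q ∈ range I := mem_range_self _

lemma hasMFDerivWithinAt_extChartAt_symm [IsManifold I ∞ M] {x₀ : M} {y : E}
    (hy : y ∈ (extChartAt I x₀).target) :
    HasMFDerivWithinAt 𝓘(ℝ, E) I (extChartAt I x₀).symm (range I) y
      (chartInvDeriv (E := E) I x₀ y) :=
  (mdifferentiableWithinAt_extChartAt_symm hy).hasMFDerivWithinAt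

lemma contDiffWithinAt_chart_representation {n : ℕ∞ω} [IsManifold I n M] [IsManifold I' n M']
    {f : M → M'} {x₀ : M} {x₁ : M'} {y : E}
    (hy : y ∈ (extChartAt I x₀).target) (hf : ContMDiffAt I I' n f ((extChartAt I x₀).symm y))
    (hx₁ : f ((extChartAt I x₀).symm y) ∈ (chartAt H' x₁).source) :
    ContDiffWithinAt ℝ n (fun z => extChartAt I' x₁ (f ((extChartAt I x₀).symm z)))
      (range I) y := by
  rw [← contMDiffWithinAt_iff_contDiffWithinAt]
  exact ((contMDiffAt_extChartAt' hx₁).comp _ hf).comp_contMDiffWithinAt y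
    (contMDiffWithinAt_extChartAt_symm_range x₀ hy)

variable [IsManifold I ∞ M] [IsManifold I' ∞ M']

/-- Both sides differentiate `f ∘ (extChartAt I x₀).symm` by the chain rule, once through the target
chart and once directly. Derivatives within `range I` are unique, also at boundary points. -/
lemma chartInvDeriv_comp_fderivWithin {f : M → M'} {x₀ : M} {x₁ : M'} {y : E}
    (hy : y ∈ (extChartAt I x₀).target) (hf : ContMDiffAt I I' 1 f ((extChartAt I x₀).symm y))
    (hx₁ : f ((extChartAt I x₀).symm y) ∈ (chartAt H' x₁).source) :
    (chartInvDeriv I' x₁ (extChartAt I' x₁ (f ((extChartAt I x₀).symm y)))).comp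
      (fderivWithin ℝ (fun z => extChartAt I' x₁ (f ((extChartAt I x₀).symm z))) (range I) y) =
    (modelDeriv I I' f ((extChartAt I x₀).symm y)).comp (chartInvDeriv I x₀ y) := by
  set ψ : E → E' := fun z => extChartAt I' x₁ (f ((extChartAt I x₀).symm z)) with hψ
  have hsource : f ((extChartAt I x₀).symm y) ∈ (extChartAt I' x₁).source := by
    rwa [extChartAt_source]
  have h1 : HasMFDerivWithinAt 𝓘(ℝ, E) I' ((extChartAt I' x₁).symm ∘ ψ) (range I) y
      ((chartInvDeriv (E := E') I' x₁ (ψ y)).comp (fderivWithin ℝ ψ (range I) y)) := by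
    refine HasMFDerivWithinAt.comp y
      (hasMFDerivWithinAt_extChartAt_symm ((extChartAt I' x₁).map_source hsource)) ?_
      (fun z _ => ?_)
    · exact ((contDiffWithinAt_chart_representation hy hf hx₁).differentiableWithinAt
        (by simp)).hasFDerivWithinAt.hasMFDerivWithinAt
    · exact extChartAt_mem_range x₁ _
  have h2 : HasMFDerivWithinAt 𝓘(ℝ, E) I' (f ∘ (extChartAt I x₀).symm) (range I) y
      ((modelDeriv (E := E) (E' := E') I I' f ((extChartAt I x₀).symm y)).comp
        (chartInvDeriv (E := E) I x₀ y)) :=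
    (hf.mdifferentiableAt (by simp)).hasMFDerivAt.comp_hasMFDerivWithinAt y
      (hasMFDerivWithinAt_extChartAt_symm hy)
  have h3 : (extChartAt I' x₁).symm ∘ ψ =ᶠ[𝓝[range I] y] f ∘ (extChartAt I x₀).symm := by
    have hc : ContinuousWithinAt (f ∘ (extChartAt I x₀).symm) (range I) y :=
      hf.continuousAt.comp_continuousWithinAt
        (hasMFDerivWithinAt_extChartAt_symm hy).1
    filter_upwards [hc.preimage_mem_nhdsWithin (extChartAt_source_mem_nhds' hsource)] with z hz
    exact (extChartAt I' x₁).left_inv hz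
  exact (I.uniqueDiffOn.uniqueMDiffOn _
    (extChartAt_target_subset_range x₀ hy)).eq h1
    (h2.congr_of_eventuallyEq h3 (h3.self_of_nhdsWithin (extChartAt_target_subset_range x₀ hy)))

lemma formInChart_formPullback {k : ℕ} {f : M → M'} (η : M' → E' [⋀^Fin k]→L[ℝ] ℝ) {x₀ : M}
    {x₁ : M'} {y : E} (hy : y ∈ (extChartAt I x₀).target)
    (hf : ContMDiffAt I I' 1 f ((extChartAt I x₀).symm y))
    (hx₁ : f ((extChartAt I x₀).symm y) ∈ (chartAt H' x₁).source) :
    formInChart I (formPullback I I' f η) x₀ y =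
      (formInChart I' η x₁ (extChartAt I' x₁ (f ((extChartAt I x₀).symm y)))).compContinuousLinearMap
        (fderivWithin ℝ (fun z => extChartAt I' x₁ (f ((extChartAt I x₀).symm z)))
          (range I) y) := by
  have h := chartInvDeriv_comp_fderivWithin hy hf hx₁
  have hsource : f ((extChartAt I x₀).symm y) ∈ (extChartAt I' x₁).source := by
    rwa [extChartAt_source]
  ext v
  simp only [formInChart, formPullback, ContinuousAlternatingMap.compContinuousLinearMap_apply,
    (extChartAt I' x₁).left_inv hsource]
  congr 1
  funext i
  exact (DFunLike.congr_fun h (v i)).symm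

/-- The pullback of a smooth form is smooth wherever the map is. -/
lemma contDiffWithinAt_formInChart_formPullback {k : ℕ} {f : M → M'}
    {η : M' → E' [⋀^Fin k]→L[ℝ] ℝ} (hη : η ∈ smoothForms I' M' k) {x₀ : M} {y : E}
    (hy : y ∈ (extChartAt I x₀).target)
    (hf : ContMDiffAt I I' ∞ f ((extChartAt I x₀).symm y)) :
    ContDiffWithinAt ℝ ∞ (formInChart I (formPullback I I' f η) x₀) (range I) y := by
  set x₁ := f ((extChartAt I x₀).symm y) with hx₁
  have hyI := extChartAt_target_subset_range x₀ hy
  have hψ := contDiffWithinAt_chart_representation hy hf (mem_chart_source H' x₁)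
  have hη' : ContDiffWithinAt ℝ ∞ (formInChart I' η x₁) (range I') (extChartAt I' x₁ x₁) :=
    (hη x₁ _ (mem_extChartAt_target x₁)).mono_of_mem_nhdsWithin
      (extChartAt_target_mem_nhdsWithin x₁)
  have h1 := hη'.comp (t := range I') y hψ fun z _ =>
    extChartAt_mem_range x₁ _
  have h2 := h1.compContinuousLinearMap_alternating
    (hψ.fderivWithin_right I.uniqueDiffOn (m := ∞) (by simp) hyI)
  refine h2.congr_of_eventuallyEq_of_mem ?_ hyI
  have hsymm : ContinuousWithinAt (extChartAt I x₀).symm (range I) y :=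
    (hasMFDerivWithinAt_extChartAt_symm hy).1
  -- The local formula with the fixed target chart at `x₁` is needed near `y`, not only at `y`.
  have hev : ∀ᶠ q in 𝓝 ((extChartAt I x₀).symm y),
      ContMDiffAt I I' 1 f q ∧ f q ∈ (chartAt H' x₁).source :=
    ((contMDiffAt_iff_contMDiffAt_nhds (by simp)).1 (hf.of_le (m := 1) (by simp))).and
      (hf.continuousAt.preimage_mem_nhds (chart_source_mem_nhds H' x₁))
  filter_upwards [hsymm.eventually hev, extChartAt_target_mem_nhdsWithin_of_mem hy]
    with z hz hzt
  exact formInChart_formPullback η hzt hz.1 hz.2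

lemma formPullback_mem_smoothForms {k : ℕ} {f : M → M'} (hf : ContMDiff I I' ∞ f)
    {η : M' → E' [⋀^Fin k]→L[ℝ] ℝ} (hη : η ∈ smoothForms I' M' k) :
    formPullback I I' f η ∈ smoothForms I M k := fun x₀ _ hy =>
  (contDiffWithinAt_formInChart_formPullback hη hy (hf _)).mono
    (extChartAt_target_subset_range x₀)

end Pullback

/-! ### Fiber integration over the projection to `M` -/

section Projection

universe u

variable {E : Type u} {H M : Type*} [NormedAddCommGroup E] [NormedSpace ℝ E] 
  [TopologicalSpace H] {I : ModelWithCorners ℝ E H}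

/-- Contraction of a form on `ℝ × E` with `∂_s`, followed by restriction to `E`. -/
def contractTime (E : Type*) [NormedAddCommGroup E] [NormedSpace ℝ E] (k : ℕ) :
    ((ℝ × E) [⋀^Fin (k + 1)]→L[ℝ] ℝ) →L[ℝ] E [⋀^Fin k]→L[ℝ] ℝ :=
  (ContinuousAlternatingMap.compContinuousLinearMapCLM (ContinuousLinearMap.inr ℝ ℝ E)).comp
    ((ContinuousLinearMap.apply ℝ _ ((1, 0) : ℝ × E)).comp
      (ContinuousAlternatingMap.curryLeftLI (𝕜 := ℝ) (E := ℝ × E) (F := ℝ)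
        (n := k)).toContinuousLinearMap)

lemma prIntegrand_eq_contractTime {k : ℕ} (β : ℝ × M → (ℝ × E) [⋀^Fin (k + 1)]→L[ℝ] ℝ) (p : M)
    (s : ℝ) : prIntegrand β p s = contractTime E k (β (s, p)) := rfl

variable [TopologicalSpace M]

/-- A form on `ℝ × M` has locally bounded support in the direction of `ℝ`. -/
def LocallyBoundedInTime {k : ℕ} (β : ℝ × M → (ℝ × E) [⋀^Fin (k + 1)]→L[ℝ] ℝ) : Prop :=
  ∀ p : M, ∃ W ∈ 𝓝 p, ∃ a : ℝ, ∀ q ∈ W, ∀ s ∉ Icc (-a) a, β (s, q) = 0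

lemma LocallyBoundedInTime.exists_prIntegrand_eq_zero {k : ℕ}
    {β : ℝ × M → (ℝ × E) [⋀^Fin (k + 1)]→L[ℝ] ℝ} (hb : LocallyBoundedInTime β) (p : M) :
    ∃ W ∈ 𝓝 p, ∃ a : ℝ, ∀ q ∈ W, ∀ s ∉ Icc (-a) a, prIntegrand β q s = 0 := by
  obtain ⟨W, hW, a, h⟩ := hb p
  exact ⟨W, hW, a, fun q hq s hs => by
    rw [prIntegrand_eq_contractTime, h q hq s hs, map_zero]⟩

variable [ChartedSpace H M]

/-- The chart of `ℝ` is the identity, so the base time `0` is immaterial and a single chart covers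
all times. -/
lemma extChartAt_real_prod (x₀ : M) : extChartAt (𝓘(ℝ, ℝ).prod I) ((0 : ℝ), x₀) =
    (PartialEquiv.refl ℝ).prod (extChartAt I x₀) := by
  rw [extChartAt_prod, extChartAt_model_space_eq_id]

lemma contDiffOn_contractTime_formInChart {k : ℕ} {β : ℝ × M → (ℝ × E) [⋀^Fin (k + 1)]→L[ℝ] ℝ}
    (hβ : β ∈ smoothForms (𝓘(ℝ, ℝ).prod I) (ℝ × M) (k + 1)) (x₀ : M) :
    ContDiffOn ℝ ∞ (fun z => contractTime E k (formInChart (𝓘(ℝ, ℝ).prod I) β ((0 : ℝ), x₀) z))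
      (univ ×ˢ (extChartAt I x₀).target) := by
  have h := hβ ((0 : ℝ), x₀)
  rw [extChartAt_real_prod] at h
  exact (contractTime E k).contDiff.comp_contDiffOn h

variable [IsManifold I ∞ M]

lemma chartInvDeriv_real_prod {x₀ : M} {y : E} (hy : y ∈ (extChartAt I x₀).target) (s : ℝ) :
    chartInvDeriv (𝓘(ℝ, ℝ).prod I) ((0 : ℝ), x₀) (s, y) =
      (ContinuousLinearMap.id ℝ ℝ).prodMap (chartInvDeriv I x₀ y) := by
  have hr : range (𝓘(ℝ, ℝ).prod I) = (univ : Set ℝ) ×ˢ range I := by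
    rw [ModelWithCorners.range_prod, modelWithCornersSelf_coe, range_id]
  have h1 : HasMFDerivWithinAt 𝓘(ℝ, ℝ × E) (𝓘(ℝ, ℝ).prod I)
      (Prod.map id (extChartAt I x₀).symm) (univ ×ˢ range I) (s, y)
      ((ContinuousLinearMap.id ℝ ℝ).prodMap (chartInvDeriv (E := E) I x₀ y)) := by
    rw [modelWithCornersSelf_prod, ← chartedSpaceSelf_prod]
    refine HasMFDerivWithinAt.prodMap ?_ ?_
    · exact (hasMFDerivAt_id s).hasMFDerivWithinAt
    · exact (hasMFDerivWithinAt_extChartAt_symm hy).mono (snd_image_prod_subset ..)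
  have hu : UniqueMDiffWithinAt 𝓘(ℝ, ℝ × E) ((univ : Set ℝ) ×ˢ range I) (s, y) :=
    (uniqueDiffOn_univ.prod I.uniqueDiffOn).uniqueMDiffOn _
      ⟨mem_univ _, extChartAt_target_subset_range x₀ hy⟩
  have h2 := h1.mfderivWithin hu
  rw [chartInvDeriv, hr, extChartAt_real_prod]
  exact h2

/-- The product chart preserves `∂_s` and the splitting, so contraction commutes with passing to the
chart. -/
lemma prIntegrand_comp_chartInvDeriv {k : ℕ} (β : ℝ × M → (ℝ × E) [⋀^Fin (k + 1)]→L[ℝ] ℝ)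
    {x₀ : M} {y : E} (hy : y ∈ (extChartAt I x₀).target) (s : ℝ) :
    (prIntegrand β ((extChartAt I x₀).symm y) s).compContinuousLinearMap (chartInvDeriv I x₀ y) =
      contractTime E k (formInChart (𝓘(ℝ, ℝ).prod I) β ((0 : ℝ), x₀) (s, y)) := by
  ext v
  have hp : (extChartAt (𝓘(ℝ, ℝ).prod I) ((0 : ℝ), x₀)).symm (s, y) =
      (s, (extChartAt I x₀).symm y) := by
    rw [extChartAt_real_prod]; rfl
  simp only [prIntegrand, contractTime, formInChart, hp, chartInvDeriv_real_prod hy]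
  simp only [ContinuousAlternatingMap.compContinuousLinearMap_apply, Function.comp_def,
    ContinuousAlternatingMap.curryLeft_apply_apply, ContinuousLinearMap.comp_apply,
    ContinuousAlternatingMap.compContinuousLinearMapCLM_apply, ContinuousLinearMap.apply_apply,
    LinearIsometry.coe_toContinuousLinearMap, ContinuousAlternatingMap.curryLeftLI_apply]
  congr 1
  funext i
  refine Fin.cases ?_ (fun j => ?_) i <;> simp

/-- The chart representation is continuous in `s`; the chart differential at `p` is invertible and
independent of `s`, so it can be undone. -/
lemma continuous_prIntegrand {k : ℕ} {β : ℝ × M → (ℝ × E) [⋀^Fin (k + 1)]→L[ℝ] ℝ}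
    (hβ : β ∈ smoothForms (𝓘(ℝ, ℝ).prod I) (ℝ × M) (k + 1)) (p : M) :
    Continuous (prIntegrand β p) := by
  have hy := mem_extChartAt_target (I := I) p
  obtain ⟨R, hR⟩ : ∃ R : E →L[ℝ] E, ∀ v, chartInvDeriv I p (extChartAt I p p) (R v) = v := by
    obtain ⟨L, hL⟩ := isInvertible_mfderivWithin_extChartAt_symm hy
    exact ⟨L.symm.toContinuousLinearMap, fun v =>
      (DFunLike.congr_fun hL (L.symm v)).symm.trans (L.apply_symm_apply v)⟩
  have h1 : Continuous fun s : ℝ =>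
      contractTime E k (formInChart (𝓘(ℝ, ℝ).prod I) β ((0 : ℝ), p) (s, extChartAt I p p)) :=
    (contDiffOn_contractTime_formInChart hβ p).continuousOn.comp_continuous (by fun_prop)
      fun s => ⟨mem_univ _, hy⟩
  have h2 := (ContinuousAlternatingMap.compContinuousLinearMapCLM (ι := Fin k) (F := ℝ)
    R).continuous.comp h1
  refine h2.congr fun s => ?_
  ext v
  simp only [Function.comp_apply, ContinuousAlternatingMap.compContinuousLinearMapCLM_apply]
  rw [← prIntegrand_comp_chartInvDeriv β hy, extChartAt_to_inv]
  simp only [ContinuousAlternatingMap.compContinuousLinearMap_apply, Function.comp_def]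
  congr 1
  funext i
  exact hR _

lemma integrable_prIntegrand {k : ℕ} {β : ℝ × M → (ℝ × E) [⋀^Fin (k + 1)]→L[ℝ] ℝ}
    (hβ : β ∈ smoothForms (𝓘(ℝ, ℝ).prod I) (ℝ × M) (k + 1)) (hb : LocallyBoundedInTime β) (p : M) :
    Integrable (prIntegrand β p) := by
  obtain ⟨W, hW, a, h⟩ := hb.exists_prIntegrand_eq_zero p
  exact (continuous_prIntegrand hβ p).integrable_of_hasCompactSupport
    (HasCompactSupport.intro isCompact_Icc (h p (mem_of_mem_nhds hW)))

lemma prIntegral_mem_smoothForms {k : ℕ} {β : ℝ × M → (ℝ × E) [⋀^Fin (k + 1)]→L[ℝ] ℝ}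
    (hβ : β ∈ smoothForms (𝓘(ℝ, ℝ).prod I) (ℝ × M) (k + 1)) (hb : LocallyBoundedInTime β)
    {A : Set ℝ} (hA : MeasurableSet A) : prIntegral A β ∈ smoothForms I M k := by
  intro x₀ y₀ hy₀
  obtain ⟨W, hW, a, h⟩ := hb.exists_prIntegrand_eq_zero ((extChartAt I x₀).symm y₀)
  have hnhds : (extChartAt I x₀).target ∩ (extChartAt I x₀).symm ⁻¹' W ∈ 𝓝[range I] y₀ :=
    Filter.inter_mem (extChartAt_target_mem_nhdsWithin_of_mem hy₀)
      ((hasMFDerivWithinAt_extChartAt_symm hy₀).1.preimage_mem_nhdsWithin hW)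
  obtain ⟨δ, hδ, hδW⟩ := Metric.mem_nhdsWithin_iff.1 hnhds
  -- A convex set with unique differentials even when `y₀` is a boundary point, on which the time
  -- support lies in `[-a, a]`.
  set C := range I ∩ Metric.ball y₀ δ with hC
  have hCW : C ⊆ (extChartAt I x₀).target ∩ (extChartAt I x₀).symm ⁻¹' W :=
    fun z hz => hδW ⟨hz.2, hz.1⟩
  have hsmooth : ContDiffOn ℝ ∞ (fun y => ∫ s in A ∩ Icc (-a) a,
      contractTime E k (formInChart (𝓘(ℝ, ℝ).prod I) β ((0 : ℝ), x₀) (s, y))) C :=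
    contDiffOn_setIntegral (I.convex_range.inter (convex_ball _ _))
      (I.uniqueDiffOn.inter Metric.isOpen_ball) isCompact_Icc inter_subset_right
      ((contDiffOn_contractTime_formInChart hβ x₀).mono
        (prod_mono_right fun z hz => (hCW hz).1))
  have hy₀C : y₀ ∈ C := ⟨extChartAt_target_subset_range x₀ hy₀, Metric.mem_ball_self hδ⟩
  have heq : ∀ y ∈ C, formInChart I (prIntegral A β) x₀ y = ∫ s in A ∩ Icc (-a) a,
      contractTime E k (formInChart (𝓘(ℝ, ℝ).prod I) β ((0 : ℝ), x₀) (s, y)) := by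
    intro y hy
    simp_rw [← prIntegrand_comp_chartInvDeriv β (hCW hy).1]
    have hint := (integrable_prIntegrand hβ hb ((extChartAt I x₀).symm y)).integrableOn
      (s := A ∩ Icc (-a) a)
    have hset : prIntegral A β ((extChartAt I x₀).symm y) =
        ∫ s in A ∩ Icc (-a) a, prIntegrand β ((extChartAt I x₀).symm y) s :=
      setIntegral_eq_of_subset_of_forall_sdiff_eq_zero hA inter_subset_left
        fun s hs => h _ (hCW hy).2 s fun hs' => hs.2 ⟨hs.1, hs'⟩
    rw [formInChart, hset]
    exact ((ContinuousAlternatingMap.compContinuousLinearMapCLM (ι := Fin k) (F := ℝ)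
      (chartInvDeriv I x₀ y)).integral_comp_comm hint).symm
  have hCn : C ∈ 𝓝[range I] y₀ := inter_mem_nhdsWithin _ (Metric.ball_mem_nhds y₀ hδ)
  exact ((hsmooth.congr heq y₀ hy₀C).mono_of_mem_nhdsWithin
    (nhdsWithin_mono _ (extChartAt_target_subset_range x₀) hCn))

end Projection

/-! ### Smooth maps do not raise dimension -/

section Dimension

variable {E H M : Type*} [NormedAddCommGroup E] [NormedSpace ℝ E] [FiniteDimensional ℝ E]
  [TopologicalSpace H] {I : ModelWithCorners ℝ E H} [TopologicalSpace M] [ChartedSpace H M]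
  [IsManifold I 1 M]
  {E' H' M' : Type*} [NormedAddCommGroup E'] [NormedSpace ℝ E'] [FiniteDimensional ℝ E']
  [TopologicalSpace H'] {I' : ModelWithCorners ℝ E' H'} [TopologicalSpace M'] [ChartedSpace H' M']
  [IsManifold I' 1 M']

/-- A continuously differentiable map whose image contains an open set does not raise the
dimension. -/
lemma finrank_le_of_image_mem_nhds {f : M → M'} {x₀ : M} {W : Set M}
    (hW : W ⊆ (extChartAt I x₀).source) (hf : ∀ x ∈ W, ContMDiffAt I I' 1 f x) {q : M'}
    (hq : f '' W ∈ 𝓝 q) : Module.finrank ℝ E' ≤ Module.finrank ℝ E := by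
  set ψ : E → E' := fun z => extChartAt I' q (f ((extChartAt I x₀).symm z)) with hψ
  set S : Set E := extChartAt I x₀ '' (W ∩ f ⁻¹' (chartAt H' q).source) with hS
  have hlip : ∀ y ∈ S, ∃ C, ∃ t ∈ 𝓝[S] y, LipschitzOnWith C ψ t := by
    rintro _ ⟨x, ⟨hx, hxq⟩, rfl⟩
    have hxs := hW hx
    have h1 : ContDiffWithinAt ℝ 1 ψ (range I) (extChartAt I x₀ x) := by
      refine contDiffWithinAt_chart_representation ((extChartAt I x₀).map_source hxs) ?_ ?_
      · rw [(extChartAt I x₀).left_inv hxs]; exact hf x hx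
      · rw [(extChartAt I x₀).left_inv hxs]; exact hxq
    obtain ⟨C, t, ht, hC⟩ := h1.exists_lipschitzOnWith I.convex_range
    refine ⟨C, t, nhdsWithin_mono _ ?_ ht, hC⟩
    rintro _ ⟨z, -, rfl⟩
    exact extChartAt_mem_range x₀ z
  have hle : dimH (ψ '' S) ≤ Module.finrank ℝ E :=
    (dimH_image_le_of_locally_lipschitzOn hlip).trans
      ((dimH_mono (subset_univ S)).trans (Real.dimH_univ_eq_finrank E).le)
  have himage : (extChartAt I' q).target ∩ (extChartAt I' q).symm ⁻¹' (f '' W) ⊆ ψ '' S := by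
    rintro z ⟨hz, x, hx, hxz⟩
    refine ⟨extChartAt I x₀ x, ⟨x, ⟨hx, ?_⟩, rfl⟩, ?_⟩
    · rw [mem_preimage, hxz, ← extChartAt_source I']
      exact (extChartAt I' q).map_target hz
    · simp only [hψ, (extChartAt I x₀).left_inv (hW hx), hxz, (extChartAt I' q).right_inv hz]
  have hnhds : ψ '' S ∈ 𝓝[range I'] (extChartAt I' q q) :=
    Filter.mem_of_superset (Filter.inter_mem (extChartAt_target_mem_nhdsWithin q)
      (mem_nhdsWithin_of_mem_nhds ((continuousAt_extChartAt_symm q).preimage_mem_nhds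
        (by rwa [extChartAt_to_inv])))) himage
  -- The point `q` may lie on the boundary, but `range I'` is in the closure of its interior, so the
  -- image still contains a nonempty open subset of `E'`.
  obtain ⟨O, hO, hqO, hOS⟩ := mem_nhdsWithin.1 hnhds
  obtain ⟨z, hzO, hzI⟩ := mem_closure_iff.1
    (I'.range_subset_closure_interior (extChartAt_mem_range q q)) O hO hqO
  have hint : (interior (ψ '' S)).Nonempty :=
    ⟨z, mem_interior.2 ⟨O ∩ interior (range I'),
      (inter_subset_inter_right _ interior_subset).trans hOS, hO.inter isOpen_interior, hzO, hzI⟩⟩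
  rw [Real.dimH_of_nonempty_interior hint] at hle
  exact_mod_cast hle

end Dimension

/-! ### Curves with zero velocity -/

section Constant

variable {E H M : Type*} [NormedAddCommGroup E] [NormedSpace ℝ E]
  [TopologicalSpace H] {I : ModelWithCorners ℝ E H} [TopologicalSpace M] [ChartedSpace H M]
  [IsManifold I 1 M]

/-- A curve with vanishing velocity is constant. -/
lemma eq_of_hasMFDerivAt_zero {γ : ℝ → M}
    (h : ∀ t, HasMFDerivAt 𝓘(ℝ, ℝ) I γ t (0 : ℝ →L[ℝ] E)) (s t : ℝ) : γ s = γ t := by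
  refine IsLocallyConstant.apply_eq_of_preconnectedSpace
    ((IsLocallyConstant.iff_eventually_eq γ).2 fun t₀ => ?_) s t
  have hc : Continuous γ := continuous_iff_continuousAt.2 fun t => (h t).1
  have hopen : IsOpen (γ ⁻¹' (chartAt H (γ t₀)).source) :=
    (chartAt H (γ t₀)).open_source.preimage hc
  obtain ⟨δ, hδ, hball⟩ := Metric.isOpen_iff.1 hopen t₀ (mem_chart_source H _)
  have hd : ∀ u ∈ Metric.ball t₀ δ,
      HasFDerivAt (extChartAt I (γ t₀) ∘ γ) (0 : ℝ →L[ℝ] E) u := fun u hu => by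
    have h1 := (mdifferentiableAt_extChartAt (I := I) (hball hu)).hasMFDerivAt.comp u (h u)
    exact h1.hasFDerivAt.congr_fderiv
      (ContinuousLinearMap.ext fun _ => (mfderiv I 𝓘(ℝ, E) (extChartAt I (γ t₀)) (γ u)).map_zero)
  filter_upwards [Metric.ball_mem_nhds t₀ hδ] with u hu
  have heq : extChartAt I (γ t₀) (γ u) = extChartAt I (γ t₀) (γ t₀) :=
    (convex_ball t₀ δ).is_const_of_fderivWithin_eq_zero (𝕜 := ℝ)
      (f := extChartAt I (γ t₀) ∘ γ)
      (fun v hv => (hd v hv).differentiableAt.differentiableWithinAt)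
      (fun v hv => ((hd v hv).hasFDerivWithinAt).fderivWithin
        (Metric.isOpen_ball.uniqueDiffWithinAt hv)) hu (Metric.mem_ball_self hδ)
  refine (extChartAt I (γ t₀)).injOn ?_ (mem_extChartAt_source _) heq
  rw [extChartAt_source]
  exact hball hu

end Constant

/-! ### Contraction with a repeated vector -/

section Alternating

/-- Contracting an alternating map with `X` kills multiples of `X` in the other arguments. -/
lemma ContinuousAlternatingMap.curryLeft_eq_of_sub_smul {E : Type*} [NormedAddCommGroup E]
    [NormedSpace ℝ E] {k : ℕ} (f : E [⋀^Fin (k + 1)]→L[ℝ] ℝ) (X : E) {u w : Fin k → E}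
    (h : ∀ i, ∃ c : ℝ, u i = w i + c • X) : f.curryLeft X u = f.curryLeft X w := by
  classical
  -- Exchange the arguments one slot at a time; `t` is the set of slots that hold `u`.
  have key : ∀ t : Finset (Fin k), f.curryLeft X (t.piecewise u w) = f.curryLeft X w := by
    intro t
    induction t using Finset.induction_on with
    | empty => simp
    | insert i t hi ih =>
      obtain ⟨c, hc⟩ := h i
      have hX : f.curryLeft X (Function.update (t.piecewise u w) i X) = 0 := by
        rw [ContinuousAlternatingMap.curryLeft_apply_apply]
        exact f.map_eq_zero_of_eq _ (i := 0) (j := i.succ) (by simp) (Fin.succ_ne_zero i).symm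
      rw [Finset.piecewise_insert, hc, ContinuousAlternatingMap.map_update_add,
        ContinuousAlternatingMap.map_update_smul, hX, smul_zero, add_zero, ← ih]
      congr 1
      rw [Function.update_eq_self_iff, Finset.piecewise_eq_of_notMem _ _ _ hi]
  simpa using key Finset.univ

end Alternating

/-! ### Points of the same orbit -/

section Orbits

variable {N : Type*} [AddAction ℝ N]

lemma orbitMap_eq_iff {p q : N} : orbitMap N p = orbitMap N q ↔ ∃ t : ℝ, t +ᵥ q = p := by
  rw [orbitMap, Quotient.eq]
  exact AddAction.orbitRel_apply

lemma orbitMap_vadd (t : ℝ) (p : N) : orbitMap N (t +ᵥ p) = orbitMap N p :=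
  orbitMap_eq_iff.2 ⟨t, rfl⟩

end Orbits

/-! ### The proper action and its fundamental vector field -/

section Flow

variable {E H N : Type*} [NormedAddCommGroup E] [NormedSpace ℝ E] [TopologicalSpace H]
  {I : ModelWithCorners ℝ E H} [TopologicalSpace N] [ChartedSpace H N] [AddAction ℝ N]

/-- A fixed point would put all of `ℝ × {p}` into the compact preimage of `(p, p)`, making `ℝ`
compact. -/
lemma exists_ne_vadd_ne [T1Space N] [ProperVAdd ℝ N] (p : N) : ∃ t : ℝ, t +ᵥ p ≠ p := by
  by_contra! h
  have hc := (ProperVAdd.isProperMap_vadd_pair (G := ℝ) (X := N)).isCompact_preimage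
    (isCompact_singleton (x := (p, p)))
  refine noncompact_univ ℝ ((hc.image continuous_fst).of_isClosed_subset isClosed_univ fun t _ => ?_)
  exact ⟨(t, p), by simp [h t], rfl⟩

lemma locallyBoundedInTime_flowPullback [LocallyCompactSpace N] [ProperVAdd ℝ N] {k : ℕ}
    {α : N → E [⋀^Fin (k + 1)]→L[ℝ] ℝ} (hα : HasCompactSupport α) :
    LocallyBoundedInTime (flowPullback I α) := by
  intro p
  obtain ⟨W, hW, hWp⟩ := exists_compact_mem_nhds p
  -- The pairs `(s, q)` with `q ∈ W` and `Θ(s, q)` in the support of `α` form a compact set, so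
  -- their times are bounded.
  have hc := (ProperVAdd.isProperMap_vadd_pair (G := ℝ) (X := N)).isCompact_preimage
    (hα.isCompact.prod hW)
  obtain ⟨a, ha⟩ := (hc.image continuous_fst).isBounded.subset_closedBall 0
  refine ⟨W, hWp, a, fun q hq s hs => ?_⟩
  have h0 : α (s +ᵥ q) = 0 := by
    by_contra hne
    refine hs ?_
    have := ha ⟨(s, q), ⟨subset_tsupport α hne, hq⟩, rfl⟩
    rwa [Real.closedBall_eq_Icc, zero_sub, zero_add] at this
  ext v
  simp [flowPullback, formPullback, flowMap, h0]

variable [ContMDiffVAdd 𝓘(ℝ, ℝ) I ∞ ℝ N]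

lemma contMDiff_flowMap : ContMDiff (𝓘(ℝ, ℝ).prod I) I ∞ (flowMap N) := contMDiff_vadd

lemma hasMFDerivAt_flowMap (z : ℝ × N) : HasMFDerivAt (𝓘(ℝ, ℝ).prod I) I (flowMap N) z
    (modelDeriv (E := ℝ × E) (E' := E) (𝓘(ℝ, ℝ).prod I) I (flowMap N) z) :=
  (contMDiff_flowMap.mdifferentiable (by simp) z).hasMFDerivAt

lemma hasMFDerivAt_vadd_left (s : ℝ) (p : N) : HasMFDerivAt I I (fun q : N => s +ᵥ q) p
    ((modelDeriv (E := ℝ × E) (E' := E) (𝓘(ℝ, ℝ).prod I) I (flowMap N) (s, p)).comp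
      (ContinuousLinearMap.inr ℝ ℝ E)) := by
  have h : HasMFDerivAt I (𝓘(ℝ, ℝ).prod I) (fun q : N => (s, q)) p
      (ContinuousLinearMap.inr ℝ ℝ E) :=
    (hasMFDerivAt_const s p).prodMk (hasMFDerivAt_id p)
  exact (hasMFDerivAt_flowMap (s, p)).comp p h

lemma hasMFDerivAt_vadd_right (s : ℝ) (p : N) : HasMFDerivAt 𝓘(ℝ, ℝ) I (fun t : ℝ => t +ᵥ p) s
    ((modelDeriv (E := ℝ × E) (E' := E) (𝓘(ℝ, ℝ).prod I) I (flowMap N) (s, p)).comp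
      (ContinuousLinearMap.inl ℝ ℝ E)) := by
  have h : HasMFDerivAt 𝓘(ℝ, ℝ) (𝓘(ℝ, ℝ).prod I) (fun t : ℝ => (t, p)) s
      (ContinuousLinearMap.inl ℝ ℝ E) :=
    (hasMFDerivAt_id s).prodMk (hasMFDerivAt_const p s)
  exact (hasMFDerivAt_flowMap (s, p)).comp s h

/-- The action map sends `∂_s` to the fundamental vector field. -/
lemma modelDeriv_flowMap_time (s : ℝ) (p : N) :
    modelDeriv (𝓘(ℝ, ℝ).prod I) I (flowMap N) (s, p) (1, 0) = flowField I (s +ᵥ p) := by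
  have h1 := hasMFDerivAt_vadd_right (I := I) 0 (s +ᵥ p)
  have h2 : HasMFDerivAt 𝓘(ℝ, ℝ) 𝓘(ℝ, ℝ) (fun t : ℝ => t + s) 0 (ContinuousLinearMap.id ℝ ℝ) :=
    ((hasFDerivAt_id (𝕜 := ℝ) (0 : ℝ)).add_const s).hasMFDerivAt
  have h3 : HasMFDerivAt 𝓘(ℝ, ℝ) I (fun t : ℝ => t +ᵥ p) (0 + s) _ :=
    hasMFDerivAt_vadd_right (I := I) (0 + s) p
  have h4 := h3.comp (0 : ℝ) h2
  have h5 : (fun t : ℝ => t +ᵥ p) ∘ (fun t : ℝ => t + s) = fun t : ℝ => t +ᵥ (s +ᵥ p) := by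
    funext t
    simp [add_vadd]
  rw [h5] at h4
  have h6 := h4.mfderiv
  have h7 := DFunLike.congr_fun h6 (1 : ℝ)
  simp only [zero_add] at h7
  exact h7.symm

/-- The fundamental vector field is invariant under the action. -/
lemma modelDeriv_flowMap_flowField (s : ℝ) (p : N) :
    modelDeriv (𝓘(ℝ, ℝ).prod I) I (flowMap N) (s, p) (0, flowField I p) =
      flowField I (s +ᵥ p) := by
  have h1 : HasMFDerivAt 𝓘(ℝ, ℝ) I (fun t : ℝ => t +ᵥ p) 0 _ :=
    hasMFDerivAt_vadd_right (I := I) 0 p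
  have h2 : HasMFDerivAt I I (fun q : N => s +ᵥ q) ((0 : ℝ) +ᵥ p) _ :=
    hasMFDerivAt_vadd_left (I := I) s ((0 : ℝ) +ᵥ p)
  have h3 := h2.comp (0 : ℝ) h1
  have h4 : (fun q : N => s +ᵥ q) ∘ (fun t : ℝ => t +ᵥ p) = fun t : ℝ => t +ᵥ (s +ᵥ p) := by
    funext t
    simp [vadd_vadd, add_comm]
  rw [h4] at h3
  have h5 := DFunLike.congr_fun h3.mfderiv (1 : ℝ)
  have h6 : flowField I (s +ᵥ p) = modelDeriv (𝓘(ℝ, ℝ).prod I) I (flowMap N) (s, (0 : ℝ) +ᵥ p)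
      (0, modelDeriv (𝓘(ℝ, ℝ).prod I) I (flowMap N) (0, p) (1, 0)) := h5
  rw [modelDeriv_flowMap_time, zero_vadd] at h6
  exact h6.symm

/-- By invariance a zero of `X` at `p` spreads along the orbit, whose parametrization is then
constant, and `p` would be fixed. -/
lemma flowField_ne_zero [T1Space N] [IsManifold I ∞ N] [ProperVAdd ℝ N] (p : N) :
    flowField I p ≠ 0 := by
  intro h0
  have hX (s : ℝ) : flowField I (s +ᵥ p) = 0 := by
    rw [← modelDeriv_flowMap_flowField, h0, Prod.mk_zero_zero, map_zero]
  obtain ⟨t, ht⟩ := exists_ne_vadd_ne p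
  refine ht ?_
  have h := eq_of_hasMFDerivAt_zero (I := I) (γ := fun t : ℝ => t +ᵥ p) (fun s => ?_) t 0
  · simpa using h
  · have h1 := hasMFDerivAt_vadd_right (I := I) s p
    have h2 : (modelDeriv (E := ℝ × E) (E' := E) (𝓘(ℝ, ℝ).prod I) I (flowMap N) (s, p)).comp
        (ContinuousLinearMap.inl ℝ ℝ E) = 0 :=
      ContinuousLinearMap.ext_ring ((modelDeriv_flowMap_time s p).trans (hX s))
    exact (congrArg (fun L : ℝ →L[ℝ] E =>
      HasMFDerivAt 𝓘(ℝ, ℝ) I (fun t : ℝ => t +ᵥ p) s L) h2).mp h1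

lemma flowPullback_mem_smoothForms [IsManifold I ∞ N] {k : ℕ} {α : N → E [⋀^Fin k]→L[ℝ] ℝ}
    (hα : α ∈ smoothForms I N k) :
    flowPullback I α ∈ smoothForms (𝓘(ℝ, ℝ).prod I) (ℝ × N) k :=
  formPullback_mem_smoothForms contMDiff_flowMap hα

lemma prIntegrand_flowPullback {k : ℕ} (α : N → E [⋀^Fin (k + 1)]→L[ℝ] ℝ) (p : N) (s : ℝ) :
    prIntegrand (flowPullback I α) p s =
      ((α (s +ᵥ p)).curryLeft (flowField I (s +ᵥ p))).compContinuousLinearMap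
        ((modelDeriv (𝓘(ℝ, ℝ).prod I) I (flowMap N) (s, p)).comp
          (ContinuousLinearMap.inr ℝ ℝ E)) := by
  rw [← modelDeriv_flowMap_time]
  ext v
  simp only [prIntegrand, flowPullback, formPullback, flowMap,
    ContinuousAlternatingMap.compContinuousLinearMap_apply,
    ContinuousAlternatingMap.curryLeft_apply_apply, Function.comp_def]
  congr 1
  funext i
  refine Fin.cases ?_ (fun j => ?_) i <;> rfl

variable [IsManifold I ∞ N] [FiniteDimensional ℝ E] [ProperVAdd ℝ N] {k : ℕ}
  {α : N → E [⋀^Fin (k + 1)]→L[ℝ] ℝ}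

lemma integrable_flowPullback (hα : α ∈ compactForms I N (k + 1)) (p : N) :
    Integrable (prIntegrand (flowPullback I α) p) := by
  have := Manifold.locallyCompact_of_finiteDimensional (M := N) I
  exact integrable_prIntegrand (flowPullback_mem_smoothForms hα.1)
    (locallyBoundedInTime_flowPullback hα.2) p

lemma prIntegral_flowPullback_mem_smoothForms (hα : α ∈ compactForms I N (k + 1)) {A : Set ℝ}
    (hA : MeasurableSet A) : prIntegral A (flowPullback I α) ∈ smoothForms I N k := by
  have := Manifold.locallyCompact_of_finiteDimensional (M := N) I
  exact prIntegral_mem_smoothForms (flowPullback_mem_smoothForms hα.1)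
    (locallyBoundedInTime_flowPullback hα.2) hA

end Flow

/-! ### The orbit space and fiber integration -/

section Quotient

variable {E H N : Type*} [NormedAddCommGroup E] [NormedSpace ℝ E] [TopologicalSpace H]
  {I : ModelWithCorners ℝ E H} [TopologicalSpace N] [ChartedSpace H N] [AddAction ℝ N]
  {E' H' : Type*} [NormedAddCommGroup E'] [NormedSpace ℝ E'] [TopologicalSpace H']
  {I' : ModelWithCorners ℝ E' H'} [ChartedSpace H' (AddAction.orbitRel.Quotient ℝ N)]

/-- Another base point shifts the time parameter, and Lebesgue measure is translation invariant. -/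
lemma fiberIntegral_orbitMap {k : ℕ} {α : N → E [⋀^Fin (k + 1)]→L[ℝ] ℝ} (p : N) :
    fiberIntegral I I' α (orbitMap N p) = ∫ s : ℝ, orbitIntegrand I I' α (s +ᵥ p) := by
  obtain ⟨t, ht⟩ := orbitMap_eq_iff.1 (Quotient.out_eq (orbitMap N p))
  rw [fiberIntegral, ← ht]
  simp_rw [vadd_vadd]
  exact integral_add_right_eq_self (fun s : ℝ => orbitIntegrand I I' α (s +ᵥ p)) t

namespace IsQuotientManifold

lemma hasMFDerivAt_orbitMap (hquot : IsQuotientManifold (N := N) I I') (p : N) :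
    HasMFDerivAt I I' (orbitMap N) p (modelDeriv (E := E) (E' := E') I I' (orbitMap N) p) :=
  (hquot.contMDiff_orbitMap.mdifferentiable (by simp) p).hasMFDerivAt

/-- Local sections of the quotient map, on open sets. -/
lemma exists_section (hquot : IsQuotientManifold (N := N) I I')
    (b : AddAction.orbitRel.Quotient ℝ N) :
    ∃ U : Set (AddAction.orbitRel.Quotient ℝ N), IsOpen U ∧ b ∈ U ∧
      ∃ σ : AddAction.orbitRel.Quotient ℝ N → N,
        (∀ c ∈ U, ContMDiffAt I' I ∞ σ c) ∧ ∀ c ∈ U, orbitMap N (σ c) = c := by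
  obtain ⟨U, hU, σ, hσ, hσ'⟩ := hquot.exists_local_section b
  refine ⟨interior U, isOpen_interior, mem_interior_iff_mem_nhds.2 hU, σ, fun c hc => ?_,
    fun c hc => hσ' c (interior_subset hc)⟩
  exact hσ.contMDiffAt (mem_interior_iff_mem_nhds.1 hc)

lemma modelDeriv_orbitMap_section (hquot : IsQuotientManifold (N := N) I I')
    {U : Set (AddAction.orbitRel.Quotient ℝ N)} (hU : IsOpen U)
    {σ : AddAction.orbitRel.Quotient ℝ N → N} (hσ : ∀ c ∈ U, ContMDiffAt I' I ∞ σ c)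
    (hσ' : ∀ c ∈ U, orbitMap N (σ c) = c) {c : AddAction.orbitRel.Quotient ℝ N} (hc : c ∈ U)
    (v : E') : modelDeriv I I' (orbitMap N) (σ c) (modelDeriv I' I σ c v) = v := by
  have h := (hquot.hasMFDerivAt_orbitMap (σ c)).comp c
    ((hσ c hc).mdifferentiableAt (by simp)).hasMFDerivAt
  have h1 : orbitMap N ∘ σ =ᶠ[𝓝 c] id := by
    filter_upwards [hU.mem_nhds hc] with d hd using hσ' d hd
  have h2 := (hasMFDerivAt_id (I := I') c).congr_of_eventuallyEq h1
  exact DFunLike.congr_fun (hasMFDerivAt_unique h h2) v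

variable [ContMDiffVAdd 𝓘(ℝ, ℝ) I ∞ ℝ N]

lemma modelDeriv_orbitMap_flowMap (hquot : IsQuotientManifold (N := N) I I') (s : ℝ) (p : N)
    (v : E) : modelDeriv I I' (orbitMap N) (s +ᵥ p)
      (modelDeriv (𝓘(ℝ, ℝ).prod I) I (flowMap N) (s, p) (0, v)) =
        modelDeriv I I' (orbitMap N) p v := by
  have h := (hquot.hasMFDerivAt_orbitMap (s +ᵥ p)).comp p (hasMFDerivAt_vadd_left (I := I) s p)
  have h1 : orbitMap N ∘ (fun q : N => s +ᵥ q) = orbitMap N := funext fun q => orbitMap_vadd s q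
  rw [h1] at h
  exact (DFunLike.congr_fun h.mfderiv v).symm

lemma modelDeriv_orbitMap_flowField (hquot : IsQuotientManifold (N := N) I I') (p : N) :
    modelDeriv I I' (orbitMap N) p (flowField I p) = 0 := by
  have h2 : HasMFDerivAt I I' (orbitMap N) ((0 : ℝ) +ᵥ p) _ :=
    hquot.hasMFDerivAt_orbitMap ((0 : ℝ) +ᵥ p)
  have h := h2.comp (0 : ℝ) (hasMFDerivAt_vadd_right (I := I) 0 p)
  have h1 : orbitMap N ∘ (fun t : ℝ => t +ᵥ p) = fun _ => orbitMap N p :=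
    funext fun t => orbitMap_vadd t p
  rw [h1] at h
  have h3 : (0 : E') = modelDeriv I I' (orbitMap N) ((0 : ℝ) +ᵥ p)
      (modelDeriv (𝓘(ℝ, ℝ).prod I) I (flowMap N) (0, p) (1, 0)) :=
    DFunLike.congr_fun ((hasMFDerivAt_const (orbitMap N p) (0 : ℝ)).mfderiv.symm.trans h.mfderiv)
      (1 : ℝ)
  rw [modelDeriv_flowMap_time, zero_vadd] at h3
  exact h3.symm

/-- A local section need not pass through `p`, only through its orbit; its differential is carried
to `p` by the action. This justifies the choice in `tangentLift`. -/
lemma exists_rightInverse (hquot : IsQuotientManifold (N := N) I I') (p : N) :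
    ∃ R : E' →L[ℝ] E, ∀ v, modelDeriv I I' (orbitMap N) p (R v) = v := by
  obtain ⟨U, hU, hpU, σ, hσ, hσ'⟩ := hquot.exists_section (orbitMap N p)
  obtain ⟨t, ht⟩ := orbitMap_eq_iff.1 (hσ' _ hpU).symm
  refine ⟨((modelDeriv (𝓘(ℝ, ℝ).prod I) I (flowMap N) (t, σ (orbitMap N p))).comp
    (ContinuousLinearMap.inr ℝ ℝ E)).comp (modelDeriv I' I σ (orbitMap N p)), fun v => ?_⟩
  have h1 := hquot.modelDeriv_orbitMap_flowMap t (σ (orbitMap N p))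
    (modelDeriv I' I σ (orbitMap N p) v)
  rw [hquot.modelDeriv_orbitMap_section hU hσ hσ' hpU, ht] at h1
  exact h1

lemma modelDeriv_tangentLift (hquot : IsQuotientManifold (N := N) I I') (p : N) (v : E') :
    modelDeriv I I' (orbitMap N) p (tangentLift I I' p v) = v :=
  Classical.epsilon_spec (hquot.exists_rightInverse p) v

variable [IsManifold I ∞ N] [IsManifold I' ∞ (AddAction.orbitRel.Quotient ℝ N)]
  [FiniteDimensional ℝ E] [FiniteDimensional ℝ E']

lemma finrank_le_succ [Nonempty N] (hquot : IsQuotientManifold (N := N) I I') :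
    Module.finrank ℝ E ≤ Module.finrank ℝ E' + 1 := by
  obtain ⟨p⟩ := ‹Nonempty N›
  set b := orbitMap N p with hb
  obtain ⟨U, hU, hbU, σ, hσ, hσ'⟩ := hquot.exists_section b
  set V := U ∩ (extChartAt I' b).source with hV
  have hVo : IsOpen V := hU.inter (isOpen_extChartAt_source b)
  have hπ : orbitMap N ⁻¹' V ∈ 𝓝 p := (hVo.preimage hquot.contMDiff_orbitMap.continuous).mem_nhds
    ⟨hbU, mem_extChartAt_source b⟩
  have h := finrank_le_of_image_mem_nhds (I := 𝓘(ℝ, ℝ).prod I') (I' := I)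
    (f := fun z : ℝ × AddAction.orbitRel.Quotient ℝ N => z.1 +ᵥ σ z.2) (x₀ := ((0 : ℝ), b))
    (W := univ ×ˢ V) (q := p) ?_ ?_ (Filter.mem_of_superset hπ ?_)
  · rwa [Module.finrank_prod, Module.finrank_self, add_comm] at h
  · rw [extChartAt_real_prod]
    exact prod_mono (subset_univ _) inter_subset_right
  · rintro ⟨s, c⟩ ⟨-, hc⟩
    have h1 : ContMDiffAt (𝓘(ℝ, ℝ).prod I') (𝓘(ℝ, ℝ).prod I) ∞
        (fun z : ℝ × AddAction.orbitRel.Quotient ℝ N => (z.1, σ z.2)) (s, c) :=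
      contMDiffAt_fst.prodMk ((hσ c hc.1).comp (s, c) contMDiffAt_snd)
    exact ((contMDiff_flowMap (I := I)).contMDiffAt.comp (s, c) h1).of_le (by simp)
  · intro q hq
    obtain ⟨t, ht⟩ := orbitMap_eq_iff.1 (hσ' _ hq.1).symm
    exact ⟨(t, orbitMap N q), ⟨mem_univ _, hq⟩, ht⟩

/-- The fundamental vector field spans the kernel of the differential of the quotient map. -/
lemma exists_eq_smul_flowField [T1Space N] [ProperVAdd ℝ N]
    (hquot : IsQuotientManifold (N := N) I I') {p : N} {v : E}
    (hv : modelDeriv I I' (orbitMap N) p v = 0) : ∃ c : ℝ, v = c • flowField I p := by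
  have : Nonempty N := ⟨p⟩
  set D : E →ₗ[ℝ] E' := (modelDeriv I I' (orbitMap N) p).toLinearMap with hD
  have hsurj : Function.Surjective D := fun w =>
    ⟨tangentLift I I' p w, hquot.modelDeriv_tangentLift p w⟩
  -- As `dπ` is onto, its kernel has dimension `dim E - dim E' ≤ 1`, so the nonzero kernel vector
  -- `X` spans it.
  have hrank := D.finrank_range_add_finrank_ker
  rw [LinearMap.range_eq_top.2 hsurj, finrank_top] at hrank
  have hker : Module.finrank ℝ (LinearMap.ker D) ≤ 1 := by
    have := hquot.finrank_le_succ
    omega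
  set X : LinearMap.ker D := ⟨flowField I p, hquot.modelDeriv_orbitMap_flowField p⟩ with hX
  have hX0 : X ≠ 0 := fun h => flowField_ne_zero (I := I) p (congrArg Subtype.val h)
  have hone : Module.finrank ℝ (LinearMap.ker D) = 1 :=
    le_antisymm hker (Module.finrank_pos_iff_exists_ne_zero.2 ⟨X, hX0⟩)
  obtain ⟨c, hc⟩ := exists_smul_eq_of_finrank_eq_one hone hX0 ⟨v, hv⟩
  exact ⟨c, (congrArg Subtype.val hc).symm⟩

variable [T1Space N] [ProperVAdd ℝ N]

lemma orbitIntegrand_comp_modelDeriv (hquot : IsQuotientManifold (N := N) I I') {k : ℕ}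
    (α : N → E [⋀^Fin (k + 1)]→L[ℝ] ℝ) (p : N) (s : ℝ) :
    (orbitIntegrand I I' α (s +ᵥ p)).compContinuousLinearMap (modelDeriv I I' (orbitMap N) p) =
      prIntegrand (flowPullback I α) p s := by
  rw [prIntegrand_flowPullback]
  ext v
  simp only [orbitIntegrand, ContinuousAlternatingMap.compContinuousLinearMap_apply]
  refine (α (s +ᵥ p)).curryLeft_eq_of_sub_smul _ fun i => ?_
  have hker : modelDeriv I I' (orbitMap N) (s +ᵥ p)
      (tangentLift I I' (s +ᵥ p) (modelDeriv I I' (orbitMap N) p (v i)) -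
        modelDeriv (𝓘(ℝ, ℝ).prod I) I (flowMap N) (s, p) (0, v i)) = 0 := by
    rw [map_sub, hquot.modelDeriv_tangentLift, hquot.modelDeriv_orbitMap_flowMap, sub_self]
  obtain ⟨c, hc⟩ := hquot.exists_eq_smul_flowField hker
  exact ⟨c, eq_add_of_sub_eq' hc⟩

/-- The chosen lifts need not vary continuously with `s`. Here they are replaced by one lift `R` at
`p`, transported by the action, so that integrability carries over from `prIntegrand`. -/
lemma orbitIntegrand_eq (hquot : IsQuotientManifold (N := N) I I') {k : ℕ}
    (α : N → E [⋀^Fin (k + 1)]→L[ℝ] ℝ) {p : N} {R : E' →L[ℝ] E}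
    (hR : ∀ v, modelDeriv I I' (orbitMap N) p (R v) = v) (s : ℝ) :
    orbitIntegrand I I' α (s +ᵥ p) =
      (prIntegrand (flowPullback I α) p s).compContinuousLinearMap R := by
  rw [← hquot.orbitIntegrand_comp_modelDeriv α p s]
  ext v
  simp only [ContinuousAlternatingMap.compContinuousLinearMap_apply, Function.comp_def, hR]

variable {k : ℕ} {α : N → E [⋀^Fin (k + 1)]→L[ℝ] ℝ}

lemma integrable_orbitIntegrand (hquot : IsQuotientManifold (N := N) I I')
    (hα : α ∈ compactForms I N (k + 1)) (p : N) :
    Integrable fun s : ℝ => orbitIntegrand I I' α (s +ᵥ p) := by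
  obtain ⟨R, hR⟩ := hquot.exists_rightInverse p
  simp_rw [hquot.orbitIntegrand_eq α hR]
  exact (ContinuousAlternatingMap.compContinuousLinearMapCLM (ι := Fin k) (F := ℝ)
    R).integrable_comp (integrable_flowPullback hα p)

lemma fiberIntegral_eq (hquot : IsQuotientManifold (N := N) I I')
    (hα : α ∈ compactForms I N (k + 1)) {p : N} {R : E' →L[ℝ] E}
    (hR : ∀ v, modelDeriv I I' (orbitMap N) p (R v) = v) :
    fiberIntegral I I' α (orbitMap N p) =
      (prIntegral univ (flowPullback I α) p).compContinuousLinearMap R := by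
  rw [fiberIntegral_orbitMap, prIntegral, setIntegral_univ]
  simp_rw [hquot.orbitIntegrand_eq α hR]
  exact (ContinuousAlternatingMap.compContinuousLinearMapCLM (ι := Fin k) (F := ℝ)
    R).integral_comp_comm (integrable_flowPullback hα p)

lemma formPullback_fiberIntegral (hquot : IsQuotientManifold (N := N) I I')
    (hα : α ∈ compactForms I N (k + 1)) :
    formPullback I I' (orbitMap N) (fiberIntegral I I' α) =
      prIntegral univ (flowPullback I α) := by
  funext p
  rw [formPullback, fiberIntegral_orbitMap, prIntegral, setIntegral_univ]
  simp_rw [← hquot.orbitIntegrand_comp_modelDeriv]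
  exact ((ContinuousAlternatingMap.compContinuousLinearMapCLM (ι := Fin k) (F := ℝ)
    (modelDeriv I I' (orbitMap N) p)).integral_comp_comm
      (hquot.integrable_orbitIntegrand hα p)).symm

lemma fiberIntegral_mem_smoothForms (hquot : IsQuotientManifold (N := N) I I')
    (hα : α ∈ compactForms I N (k + 1)) :
    fiberIntegral I I' α ∈ smoothForms I' (AddAction.orbitRel.Quotient ℝ N) k := by
  intro x₀ y hy
  obtain ⟨U, hU, hbU, σ, hσ, hσ'⟩ := hquot.exists_section ((extChartAt I' x₀).symm y)
  -- Take `R = dσ_c`, a right inverse of `dπ` at `σ c`.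
  have heq : ∀ c ∈ U, fiberIntegral I I' α c =
      formPullback I' I σ (prIntegral univ (flowPullback I α)) c := fun c hc => by
    have h := hquot.fiberIntegral_eq hα (hquot.modelDeriv_orbitMap_section hU hσ hσ' hc)
    rwa [hσ' c hc] at h
  have h1 := contDiffWithinAt_formInChart_formPullback
    (prIntegral_flowPullback_mem_smoothForms hα MeasurableSet.univ) hy (hσ _ hbU)
  have hyI := extChartAt_target_subset_range x₀ hy
  refine (h1.congr_of_eventuallyEq_of_mem ?_ hyI).mono (extChartAt_target_subset_range x₀)
  filter_upwards [(hasMFDerivWithinAt_extChartAt_symm hy).1.preimage_mem_nhdsWithin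
    (hU.mem_nhds hbU)] with z hz
  rw [formInChart, formInChart, heq _ hz]

end IsQuotientManifold

end Quotient

/-! ### The Green operators as linear maps -/

section Green

variable {E H N : Type*} [NormedAddCommGroup E] [NormedSpace ℝ E] [TopologicalSpace H]
  {I : ModelWithCorners ℝ E H} [TopologicalSpace N] [ChartedSpace H N] [AddAction ℝ N]

lemma prIntegrand_flowPullback_add {k : ℕ} (α β : N → E [⋀^Fin (k + 1)]→L[ℝ] ℝ) (p : N) (s : ℝ) :
    prIntegrand (flowPullback I (α + β)) p s =
      prIntegrand (flowPullback I α) p s + prIntegrand (flowPullback I β) p s := by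
  ext v
  simp [prIntegrand, flowPullback, formPullback]

lemma prIntegrand_flowPullback_smul {k : ℕ} (c : ℝ) (α : N → E [⋀^Fin (k + 1)]→L[ℝ] ℝ) (p : N)
    (s : ℝ) : prIntegrand (flowPullback I (c • α)) p s =
      c • prIntegrand (flowPullback I α) p s := by
  ext v
  simp [prIntegrand, flowPullback, formPullback]

lemma greenForward_sub_greenBackward {k : ℕ} {α : N → E [⋀^Fin (k + 1)]→L[ℝ] ℝ}
    (h : ∀ p, Integrable (prIntegrand (flowPullback I α) p)) :
    greenForward I α - greenBackward I α = prIntegral univ (flowPullback I α) := by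
  funext p
  simp only [greenForward, greenBackward, Pi.sub_apply, Pi.neg_apply, sub_neg_eq_add, prIntegral,
    setIntegral_univ, integral_Ici_eq_integral_Ioi]
  exact intervalIntegral.integral_Iic_add_Ioi (h p).integrableOn (h p).integrableOn

variable [FiniteDimensional ℝ E] [IsManifold I ∞ N] [ContMDiffVAdd 𝓘(ℝ, ℝ) I ∞ ℝ N]
  [ProperVAdd ℝ N]

variable (I)

/-- Integration of `Θ^* α` over a measurable set of times, as a linear map on compactly supported
smooth forms. -/
def flowIntegralLinearMap {A : Set ℝ} (hA : MeasurableSet A) (k : ℕ) :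
    compactForms I N (k + 1) →ₗ[ℝ] smoothForms I N k where
  toFun α := ⟨prIntegral A (flowPullback I α.1),
    prIntegral_flowPullback_mem_smoothForms α.2 hA⟩
  map_add' α β := Subtype.ext <| funext fun p => by
    simp only [prIntegral, Submodule.coe_add, prIntegrand_flowPullback_add, Pi.add_apply]
    exact integral_add (integrable_flowPullback α.2 p).integrableOn
      (integrable_flowPullback β.2 p).integrableOn
  map_smul' c α := Subtype.ext <| funext fun p => by
    simp only [prIntegral, Submodule.coe_smul, prIntegrand_flowPullback_smul, Pi.smul_apply,
      RingHom.id_apply]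
    exact integral_smul c _

/-- The backward Green operator as a linear map on compactly supported smooth forms. -/
def greenBackwardLinearMap (k : ℕ) :
    compactForms I N (k + 1) →ₗ[ℝ] smoothForms I N k where
  toFun α := ⟨greenBackward I α.1,
    (smoothForms I N k).neg_mem (prIntegral_flowPullback_mem_smoothForms α.2 measurableSet_Ici)⟩
  map_add' α β := Subtype.ext <| by
    have h : prIntegral (Ici 0) (flowPullback I (α + β).1) =
        prIntegral (Ici 0) (flowPullback I α.1) + prIntegral (Ici 0) (flowPullback I β.1) :=
      congrArg Subtype.val ((flowIntegralLinearMap I measurableSet_Ici k).map_add α β)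
    simp only [greenBackward, h, neg_add]
    rfl
  map_smul' c α := Subtype.ext <| by
    have h : prIntegral (Ici 0) (flowPullback I (c • α).1) =
        c • prIntegral (Ici 0) (flowPullback I α.1) :=
      congrArg Subtype.val ((flowIntegralLinearMap I measurableSet_Ici k).map_smul c α)
    simp only [greenBackward, h]
    exact (smul_neg c _).symm

end Green

/-! ### Pullback and fiber integration as linear maps -/

section Pullback

variable {E H N : Type*} [NormedAddCommGroup E] [NormedSpace ℝ E] [TopologicalSpace H]
  {I : ModelWithCorners ℝ E H} [TopologicalSpace N] [ChartedSpace H N] [AddAction ℝ N]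
  [IsManifold I ∞ N]
  {E' H' : Type*} [NormedAddCommGroup E'] [NormedSpace ℝ E'] [TopologicalSpace H']
  {I' : ModelWithCorners ℝ E' H'} [ChartedSpace H' (AddAction.orbitRel.Quotient ℝ N)]
  [IsManifold I' ∞ (AddAction.orbitRel.Quotient ℝ N)]

namespace IsQuotientManifold

/-- The pullback along the quotient map as a linear map on smooth forms. -/
def pullbackLinearMap (hquot : IsQuotientManifold (N := N) I I') (k : ℕ) :
    smoothForms I' (AddAction.orbitRel.Quotient ℝ N) k →ₗ[ℝ] smoothForms I N k where
  toFun β := ⟨formPullback I I' (orbitMap N) β.1,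
    formPullback_mem_smoothForms hquot.contMDiff_orbitMap β.2⟩
  map_add' α β := Subtype.ext <| funext fun p => by
    ext v
    simp [formPullback]
  map_smul' c α := Subtype.ext <| funext fun p => by
    ext v
    simp [formPullback]

/-- Fiber integration along the quotient map as a linear map on compactly supported smooth
forms. -/
def fiberIntegralLinearMap [FiniteDimensional ℝ E] [FiniteDimensional ℝ E']
    [ContMDiffVAdd 𝓘(ℝ, ℝ) I ∞ ℝ N] [ProperVAdd ℝ N] [T1Space N]
    (hquot : IsQuotientManifold (N := N) I I') (k : ℕ) :
    compactForms I N (k + 1) →ₗ[ℝ] smoothForms I' (AddAction.orbitRel.Quotient ℝ N) k where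
  toFun α := ⟨fiberIntegral I I' α.1, hquot.fiberIntegral_mem_smoothForms α.2⟩
  map_add' α β := Subtype.ext <| funext fun b => by
    have h (s : ℝ) : orbitIntegrand I I' (α.1 + β.1) (s +ᵥ b.out) =
        orbitIntegrand I I' α.1 (s +ᵥ b.out) + orbitIntegrand I I' β.1 (s +ᵥ b.out) := by
      ext v
      simp [orbitIntegrand]
    simp only [fiberIntegral, Submodule.coe_add, h, Pi.add_apply]
    exact integral_add (hquot.integrable_orbitIntegrand α.2 b.out)
      (hquot.integrable_orbitIntegrand β.2 b.out)
  map_smul' c α := Subtype.ext <| funext fun b => by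
    have h (s : ℝ) : orbitIntegrand I I' (c • α.1) (s +ᵥ b.out) =
        c • orbitIntegrand I I' α.1 (s +ᵥ b.out) := by
      ext v
      simp [orbitIntegrand]
    simp only [fiberIntegral, Submodule.coe_smul, h, Pi.smul_apply, RingHom.id_apply]
    exact integral_smul c _

end IsQuotientManifold

end Pullback

end

theorem mainTheorem12
    {E H N : Type*} [NormedAddCommGroup E] [NormedSpace ℝ E] [FiniteDimensional ℝ E]
    [TopologicalSpace H] (I : ModelWithCorners ℝ E H)
    [TopologicalSpace N] [T2Space N] [SecondCountableTopology N]
    [ChartedSpace H N] [IsManifold I ∞ N]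
    [AddAction ℝ N] [ContMDiffVAdd 𝓘(ℝ, ℝ) I ∞ ℝ N] [ProperVAdd ℝ N]
    {E' H' : Type*} [NormedAddCommGroup E'] [NormedSpace ℝ E'] [FiniteDimensional ℝ E']
    [TopologicalSpace H'] (I' : ModelWithCorners ℝ E' H')
    [ChartedSpace H' (AddAction.orbitRel.Quotient ℝ N)]
    [IsManifold I' ∞ (AddAction.orbitRel.Quotient ℝ N)]
    (hquot : IsQuotientManifold (N := N) I I') :
    -- all the integrals converge
    (∀ (k : ℕ) (α : compactForms I N (k + 1)) (p : N),
      IntegrableOn (prIntegrand (flowPullback I α.1) p) (Iic 0) ∧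
      IntegrableOn (prIntegrand (flowPullback I α.1) p) (Ici 0) ∧
      Integrable (fun s : ℝ => orbitIntegrand I I' α.1 (s +ᵥ p))) ∧
    -- the formulas define linear maps between spaces of smooth forms, and these satisfy
    -- `G^↑ - G^↓ = π^* ∘ π_*`
    ∃ (Gup Gdown : ∀ k : ℕ, compactForms I N (k + 1) →ₗ[ℝ] smoothForms I N k)
      (piPush : ∀ k : ℕ, compactForms I N (k + 1) →ₗ[ℝ]
        smoothForms I' (AddAction.orbitRel.Quotient ℝ N) k)
      (piPull : ∀ k : ℕ, smoothForms I' (AddAction.orbitRel.Quotient ℝ N) k →ₗ[ℝ]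
        smoothForms I N k),
      (∀ k α, (Gup k α).1 = greenForward I α.1) ∧
      (∀ k α, (Gdown k α).1 = greenBackward I α.1) ∧
      (∀ k α, (piPush k α).1 = fiberIntegral I I' α.1) ∧
      (∀ k β, (piPull k β).1 = formPullback I I' (orbitMap N) β.1) ∧
      ∀ k α, Gup k α - Gdown k α = piPull k (piPush k α) := by
  refine ⟨fun k α p => ⟨(integrable_flowPullback α.2 p).integrableOn,
    (integrable_flowPullback α.2 p).integrableOn, hquot.integrable_orbitIntegrand α.2 p⟩,
    flowIntegralLinearMap (N := N) I measurableSet_Iic,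
    greenBackwardLinearMap (N := N) I,
    hquot.fiberIntegralLinearMap, hquot.pullbackLinearMap, fun k α => rfl, fun k α => rfl,
    fun k α => rfl, fun k β => rfl, fun k α => Subtype.ext ?_⟩
  -- Both sides are the integral of `Θ^*α` over `ℝ`.
  exact (greenForward_sub_greenBackward (integrable_flowPullback α.2)).trans
    (hquot.formPullback_fiberIntegral α.2).symm
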